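/- Let $\mathbb F$ be a field of characteristic zero, let $N,T,t,d,k,\Delta\ge 0$ be integers, and fix any monomial ordering on the monomials in $X_1,\dots,X_N$. Let $P\in\mathbb F[X_1,\dots,X_N]$ be a nonzero homogeneous polynomial of degree $\Delta$ such that $$P=\sum_{i=1}^T C_i(Q_{i1},Q_{i2},\dots,Q_{it}),$$ where each $C_i$ is a polynomial in $t$ variables over $\mathbb F$, each $Q_{ij}\in\mathbb F[X_1,\dots,X_N]$ has degree at most $d$, and for each $i\in\{1,\dots,T\}$ the algebraic rank of the set $\{Q_{ij}: 1\le j\le t\}$, that is, the size of a maximal subset of it that is algebraically independent over $\mathbb F$, is at most $k$. Then the trailing monomial of $P$ (the smallest monomial, in the given ordering, with nonzero coefficient in $P$) has support at most $$2e^3 d\cdot\bigl(\ln(T(\Delta+1))+(d+1)k\,\ln(2(d+1)k)+1\bigr),$$ that is, at most this many variables occur in it with nonzero exponent. Here $e$ is the base of the natural logarithm, and $0\ln 0$ is read as $0$ when $k=0$. -/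

import Mathlib

open MvPolynomial
open scoped MonomialOrder

/-- `B` is a transcendence basis of the set `S` of polynomials: a maximal subset of `S`
which is algebraically independent over `F`. -/
def IsTransBasisOfSet {σ F : Type*} [Field F] (S B : Set (MvPolynomial σ F)) : Prop :=
  Maximal (fun B : Set (MvPolynomial σ F) =>
    B ⊆ S ∧ AlgebraicIndependent F (fun q : B => (q : MvPolynomial σ F))) B

/-- The algebraic rank of a set `S` of polynomials: the size of a transcendence basis of `S`.
All of them have the same size (`algebraicRank_eq_encard`), so the supremum is that size. -/
noncomputable def algebraicRank {σ F : Type*} [Field F] (S : Set (MvPolynomial σ F)) : ℕ∞ :=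
  ⨆ B : {B : Set (MvPolynomial σ F) // IsTransBasisOfSet S B}, B.1.encard

/-- `α` is (the exponent vector of) the trailing monomial of `P` with respect to the monomial
ordering `m`: the minimal one among the monomials with a nonzero coefficient in `P`. -/
def IsTrailingMonomial {σ F : Type*} [Field F] (m : MonomialOrder σ) (P : MvPolynomial σ F)
    (α : σ →₀ ℕ) : Prop :=
  α ∈ P.support ∧ ∀ β ∈ P.support, α ≼[m] β

theorem IsTransBasisOfSet.isBasis {σ F : Type*} [Field F] {S B : Set (MvPolynomial σ F)}
    (h : IsTransBasisOfSet S B) :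
    (AlgebraicIndependent.matroid F (MvPolynomial σ F)).IsBasis B S := by
  rw [Matroid.isBasis_iff]
  refine ⟨h.prop.2, h.prop.1, fun J hJ hBJ hJS => ?_⟩
  exact le_antisymm hBJ (h.le_of_ge ⟨hJS, hJ⟩ hBJ)

theorem algebraicRank_eq_encard {σ F : Type*} [Field F] {S B : Set (MvPolynomial σ F)}
    (h : IsTransBasisOfSet S B) : algebraicRank S = B.encard := by
  refine le_antisymm (iSup_le fun B' => ?_)
    (le_iSup (fun B : {B : Set (MvPolynomial σ F) // IsTransBasisOfSet S B} => B.1.encard) ⟨B, h⟩)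
  rw [B'.2.isBasis.encard_eq_eRk, h.isBasis.encard_eq_eRk]

/-! The proof has two stages. The first replaces the inner polynomials of each summand by `k * (d +
1)` polynomials of degree at most `d`. Each `Q i j` is algebraic over a transcendence basis `B i`
with at most `k` elements, and in characteristic zero it is a simple root of a polynomial over that
subalgebra. Simplicity persists at a generic point `a`; after translating `a` to the origin, Newton
iteration (`mem_of_isRoot_of_constantCoeff_ne_zero`) puts `Q i j` in the graded algebra generated by
the homogeneous components of the translated basis. Taking degree `Δ` components recovers `P`, since
translation preserves the top component.

The second stage uses shifted partial derivatives. Setting the variables outside the trailing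
monomial `α` to zero, one may assume that all `N` variables occur in `α`. Squarefree derivatives of
order `l`, shifted by monomials of degree at most `m` in the other variables, have distinct trailing
monomials, so they are independent. By the chain rule they lie in a space of small dimension. The
resulting inequality (`choose_mul_choose_le_of_trailing`) fails for large `N` with suitable `l` and
`m` (`le_of_forall_choose_mul_choose_le`). -/

/-! ### Homogeneous components and translations. -/

/-- A subalgebra generated by homogeneous polynomials is closed under taking homogeneous
components. -/
theorem homogeneousComponent_mem_adjoin {σ F : Type*} [Field F] {G : Set (MvPolynomial σ F)}
    (hG : ∀ g ∈ G, ∃ n, g.IsHomogeneous n) {p : MvPolynomial σ F}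
    (hp : p ∈ Algebra.adjoin F G) (r : ℕ) :
    homogeneousComponent r p ∈ Algebra.adjoin F G := by
  classical
  rw [← Subalgebra.mem_toSubmodule] at hp ⊢
  rw [Algebra.adjoin_eq_span] at hp
  induction hp using Submodule.span_induction with
  | zero => simp
  | add x y _ _ hx hy => rw [map_add]; exact add_mem hx hy
  | smul a x _ hx => rw [map_smul]; exact Submodule.smul_mem _ _ hx
  | mem x hx =>
    have h1 : ∃ n, x.IsHomogeneous n := by
      induction hx using Submonoid.closure_induction with
      | mem x hx => exact hG x hx
      | one => exact ⟨0, isHomogeneous_one _ _⟩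
      | mul x y _ _ hx hy =>
        obtain ⟨a, ha⟩ := hx
        obtain ⟨b, hb⟩ := hy
        exact ⟨a + b, ha.mul hb⟩
    obtain ⟨n, hn⟩ := h1
    rw [homogeneousComponent_of_mem hn]
    split_ifs
    · rw [Algebra.adjoin_eq_span]; exact Submodule.subset_span hx
    · exact zero_mem _

theorem homogeneousComponent_mul_of_totalDegree_le {σ F : Type*} [Field F]
    {p q : MvPolynomial σ F} {a b : ℕ} (hp : p.totalDegree ≤ a) (hq : q.totalDegree ≤ b) :
    homogeneousComponent (a + b) (p * q) = homogeneousComponent a p * homogeneousComponent b q := by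
  classical
  ext s
  rw [coeff_homogeneousComponent, coeff_mul, coeff_mul]
  split_ifs with h
  · refine Finset.sum_congr rfl fun ⟨u, v⟩ huv => ?_
    rw [Finset.HasAntidiagonal.mem_antidiagonal] at huv
    simp only at huv
    rw [← huv, map_add] at h
    simp only [coeff_homogeneousComponent]
    by_cases hu : u.degree = a
    · have hv : v.degree = b := by omega
      simp [hu, hv]
    · rw [if_neg hu, zero_mul]
      rcases lt_or_gt_of_ne hu with hu | hu
      · rw [coeff_eq_zero_of_totalDegree_lt (f := q) (d := v), mul_zero]
        exact hq.trans_lt (show b < v.degree by omega)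
      · rw [coeff_eq_zero_of_totalDegree_lt (f := p) (d := u), zero_mul]
        exact hp.trans_lt (show a < u.degree by omega)
  · refine (Finset.sum_eq_zero fun ⟨u, v⟩ huv => ?_).symm
    rw [Finset.HasAntidiagonal.mem_antidiagonal] at huv
    simp only at huv
    rw [← huv, map_add] at h
    simp only [coeff_homogeneousComponent]
    by_cases hu : u.degree = a
    · have hv : v.degree ≠ b := by omega
      simp [hv]
    · simp [hu]

/-- The translation `X ↦ X + a`. -/
noncomputable def translateVars {σ F : Type*} [Field F] (a : σ → F) :
    MvPolynomial σ F →ₐ[F] MvPolynomial σ F :=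
  aeval fun i => X i + C (a i)

/-- Translation alters a monomial only in lower degrees. The degree is left existential so that the
induction can add one variable at a time; for `c ≠ 0` it is determined. -/
theorem homogeneousComponent_translateVars_monomial {σ F : Type*} [Field F] (a : σ → F) (s : σ →₀ ℕ)
    (c : F) : ∃ n, (monomial s c).IsHomogeneous n ∧ (translateVars a (monomial s c)).totalDegree ≤ n ∧
      homogeneousComponent n (translateVars a (monomial s c)) = monomial s c := by
  refine induction_on_monomial (motive := fun p => ∃ n, p.IsHomogeneous n ∧
    (translateVars a p).totalDegree ≤ n ∧ homogeneousComponent n (translateVars a p) = p) ?_ ?_ s c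
  · intro c
    refine ⟨0, isHomogeneous_C _ _, ?_, ?_⟩
    · simp [translateVars]
    · simp [translateVars]
  · rintro p i ⟨n, h1, h2, h3⟩
    have hX : translateVars a (X i) = X i + C (a i) := by simp [translateVars]
    have hd : (X i + C (a i) : MvPolynomial σ F).totalDegree ≤ 1 :=
      (totalDegree_add _ _).trans (by simp)
    refine ⟨n + 1, h1.mul (isHomogeneous_X _ _), ?_, ?_⟩
    · rw [map_mul, hX]
      exact (totalDegree_mul _ _).trans (by omega)
    · rw [map_mul, hX, homogeneousComponent_mul_of_totalDegree_le h2 hd, h3, map_add,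
        homogeneousComponent_of_mem (isHomogeneous_X F i), homogeneousComponent_of_mem
          (isHomogeneous_C σ (a i))]
      simp

theorem totalDegree_translateVars_le {σ F : Type*} [Field F] (a : σ → F) (p : MvPolynomial σ F) :
    (translateVars a p).totalDegree ≤ p.totalDegree := by
  conv_lhs => rw [p.as_sum, map_sum]
  refine totalDegree_finsetSum_le fun s hs => ?_
  obtain ⟨n, h1, h2, -⟩ := homogeneousComponent_translateVars_monomial a s (coeff s p)
  refine h2.trans ?_
  rw [← h1.totalDegree (by simpa using hs), totalDegree_monomial _ (by simpa using hs)]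
  exact le_totalDegree hs

theorem homogeneousComponent_translateVars {σ F : Type*} [Field F] (a : σ → F)
    {p : MvPolynomial σ F} {n : ℕ} (hp : p.IsHomogeneous n) :
    homogeneousComponent n (translateVars a p) = p := by
  conv_rhs => rw [p.as_sum]
  conv_lhs => rw [p.as_sum, map_sum, map_sum]
  refine Finset.sum_congr rfl fun s hs => ?_
  obtain ⟨r, h1, -, h3⟩ := homogeneousComponent_translateVars_monomial a s (coeff s p)
  have hc : coeff s p ≠ 0 := by simpa using hs
  have : r = n := h1.inj_right (isHomogeneous_monomial _ (by
    rw [Finsupp.degree_eq_weight_one]; exact hp hc)) (by simpa using hc)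
  rw [← this, h3]

/-! ### Simple roots and Newton iteration. -/

/-- A simple root lies in every subalgebra that contains the coefficients and is closed under
homogeneous components, where simplicity is tested at the origin. -/
theorem mem_of_isRoot_of_constantCoeff_ne_zero {σ F : Type*} [Field F]
    {S : Subalgebra F (MvPolynomial σ F)}
    (hS : ∀ p ∈ S, ∀ r, homogeneousComponent r p ∈ S)
    {A : Polynomial (MvPolynomial σ F)} (hA : ∀ n, A.coeff n ∈ S) {z : MvPolynomial σ F}
    (hz : A.eval z = 0) (hz' : constantCoeff (A.derivative.eval z) ≠ 0) : z ∈ S := by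
  set c := constantCoeff (A.derivative.eval z) with hc
  have hmem : ∀ p : MvPolynomial σ F, p ∈ idealOfVars σ F ↔ constantCoeff p = 0 := by
    intro p
    rw [← pow_one (idealOfVars σ F), mem_pow_idealOfVars_iff']
    refine ⟨fun h => h 0 (by simp), fun h x hx => ?_⟩
    have : x = 0 := (Finsupp.degree_eq_zero_iff x).1 (Nat.lt_one_iff.1 hx)
    rw [this]; exact h
  have approx : ∀ r, ∃ s ∈ S, z - s ∈ idealOfVars σ F ^ (r + 1) := by
    intro r
    induction r with
    | zero =>
      exact ⟨C (constantCoeff z), S.algebraMap_mem _, by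
        rw [zero_add, pow_one, hmem]; simp⟩
    | succ r ih =>
      obtain ⟨s, hs, hzs⟩ := ih
      -- Newton step with the fixed slope `c`. It stays in `S` because `c` is a scalar.
      refine ⟨s - C c⁻¹ * A.eval s, S.sub_mem hs (S.mul_mem (S.algebraMap_mem _) ?_), ?_⟩
      · rw [Polynomial.eval_eq_sum, Polynomial.sum_def]
        exact S.sum_mem fun n _ => S.mul_mem (hA n) (S.pow_mem hs n)
      · obtain ⟨k, hk⟩ := A.binomExpansion z (s - z)
        rw [add_sub_cancel, hz, zero_add] at hk
        -- Taylor expansion at the root `z`. The second factor has zero constant term, so each step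
        -- gains one order of vanishing.
        have : z - (s - C c⁻¹ * A.eval s) =
            (z - s) * (1 - C c⁻¹ * A.derivative.eval z + C c⁻¹ * k * (z - s)) := by
          rw [hk]; ring
        rw [this, pow_succ]
        refine Ideal.mul_mem_mul hzs ?_
        have h0 : constantCoeff (z - s) = 0 :=
          (hmem _).1 (Ideal.pow_le_self (by omega) hzs)
        rw [hmem, map_add, map_mul _ _ (z - s), h0, map_sub, map_mul, ← hc]
        simp [hz']
  rw [← sum_homogeneousComponent z]
  refine S.sum_mem fun r _ => ?_
  obtain ⟨s, hs, hzs⟩ := approx r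
  have : homogeneousComponent r z = homogeneousComponent r s := by
    rw [← sub_eq_zero, ← map_sub]
    ext x
    rw [coeff_homogeneousComponent]
    split_ifs with hx
    · rw [mem_pow_idealOfVars_iff'] at hzs
      rw [hzs x (by omega), coeff_zero]
    · simp
  rw [this]
  exact hS s hs r

/-- An element algebraic over a subalgebra is a simple root of a polynomial over it. -/
theorem exists_simple_root {A F : Type*} [Field F] [CharZero F] [CommRing A] [IsDomain A]
    [Algebra F A] {K : Subalgebra F A} {z : A} (hz : IsAlgebraic K z) :
    ∃ p : Polynomial K, Polynomial.aeval z p = 0 ∧ Polynomial.aeval z p.derivative ≠ 0 := by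
  classical
  have hex : ∃ n, ∃ p : Polynomial K, p ≠ 0 ∧ Polynomial.aeval z p = 0 ∧ p.natDegree = n := by
    obtain ⟨p, h1, h2⟩ := hz
    exact ⟨_, p, h1, h2, rfl⟩
  obtain ⟨p, h1, h2, h3⟩ := Nat.find_spec hex
  refine ⟨p, h2, fun h4 => ?_⟩
  have : CharZero K := charZero_of_injective_algebraMap (FaithfulSMul.algebraMap_injective F K)
  have hpos : p.natDegree ≠ 0 := by
    intro h0
    rw [Polynomial.eq_C_of_natDegree_eq_zero h0] at h1 h2
    simp only [Polynomial.aeval_C] at h2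
    apply h1
    rw [(FaithfulSMul.algebraMap_injective K A) (h2.trans (map_zero _).symm), map_zero]
  have hlt := Polynomial.natDegree_derivative_lt hpos
  refine Nat.find_min hex (m := p.derivative.natDegree) (by omega) ⟨_, ?_, h4, rfl⟩
  intro h5
  exact hpos (Polynomial.derivative_eq_zero.1 h5)

/-! ### Reduction to few inner polynomials. -/

theorem exists_isTransBasisOfSet {σ F : Type*} [Field F] (S : Set (MvPolynomial σ F)) :
    ∃ B, IsTransBasisOfSet S B := by
  obtain ⟨B, hB⟩ := (AlgebraicIndependent.matroid F (MvPolynomial σ F)).exists_isBasis S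
  refine ⟨B, ⟨hB.subset, hB.indep⟩, fun J hJ hBJ => ?_⟩
  exact (hB.eq_of_subset_indep hJ.2 hBJ hJ.1).ge

theorem exists_fun_range_of_encard_le {X : Type*} [Zero X] {B : Set X} {k : ℕ}
    (hB : B.encard ≤ k) : ∃ f : Fin k → X, B ⊆ Set.range f := by
  classical
  have hfin : B.Finite := Set.finite_of_encard_le_coe hB
  have := hfin.to_subtype
  have := Fintype.ofFinite B
  have hc : Fintype.card B ≤ Fintype.card (Fin k) := by
    rw [Fintype.card_fin]
    rw [Set.encard_eq_coe_toFinset_card, Set.toFinset_card] at hB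
    exact_mod_cast hB
  obtain ⟨e⟩ := Function.Embedding.nonempty_of_card_le hc
  exact ⟨Function.extend e (↑) 0, fun b hb => ⟨e ⟨b, hb⟩, by simp [e.injective.extend_apply]⟩⟩

/-- After a generic translation, polynomials algebraic over `B` lie in the subalgebra generated by
the homogeneous components of the translates of `B`. -/
theorem translateVars_mem_adjoin {σ F : Type*} [Field F] {G B : Set (MvPolynomial σ F)}
    (hG : ∀ g ∈ G, ∃ n, g.IsHomogeneous n) {a : σ → F}
    (hB : ∀ b ∈ B, translateVars a b ∈ Algebra.adjoin F G) {z : MvPolynomial σ F}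
    {p : Polynomial (Algebra.adjoin F B)} (hz : Polynomial.aeval z p = 0)
    (hz' : eval a (Polynomial.aeval z p.derivative) ≠ 0) :
    translateVars a z ∈ Algebra.adjoin F G := by
  set φ : Algebra.adjoin F B →+* MvPolynomial σ F :=
    (translateVars a).toRingHom.comp (algebraMap (Algebra.adjoin F B) (MvPolynomial σ F)) with hφ
  have key : ∀ q : Polynomial (Algebra.adjoin F B),
      (q.map φ).eval (translateVars a z) = translateVars a (Polynomial.aeval z q) := by
    intro q
    rw [Polynomial.eval_map, Polynomial.aeval_def, ← AlgHom.coe_toRingHom, Polynomial.hom_eval₂]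
    rfl
  have hle : Algebra.adjoin F B ≤ (Algebra.adjoin F G).comap (translateVars a) :=
    Algebra.adjoin_le hB
  refine mem_of_isRoot_of_constantCoeff_ne_zero (A := p.map φ)
    (fun q hq r => homogeneousComponent_mem_adjoin hG hq r) (fun n => ?_) ?_ ?_
  · rw [Polynomial.coeff_map]
    exact hle (p.coeff n).2
  · rw [key, hz, map_zero]
  · rw [Polynomial.derivative_map, key]
    -- Translation turns evaluation at `a` into the constant term.
    have h0 : ∀ q : MvPolynomial σ F, constantCoeff (translateVars a q) = eval a q := by
      intro q
      have : (constantCoeff.comp (translateVars a).toRingHom : MvPolynomial σ F →+* F) = eval a := by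
        ext i <;> simp [translateVars]
      exact congrArg (fun f : MvPolynomial σ F →+* F => f q) this
    rwa [h0]

/-- A homogeneous sum of compositions of low algebraic rank is a sum of compositions with few
inner polynomials. -/
theorem exists_rep_of_algebraicRank_le {σ F : Type*} [Field F] [CharZero F] {T t d k Δ : ℕ}
    {P : MvPolynomial σ F} (hP : P.IsHomogeneous Δ)
    (C : Fin T → MvPolynomial (Fin t) F) (Q : Fin T → Fin t → MvPolynomial σ F)
    (hrep : P = ∑ i, aeval (Q i) (C i)) (hdeg : ∀ i j, (Q i j).totalDegree ≤ d)
    (hrank : ∀ i, algebraicRank (Set.range (Q i)) ≤ (k : ℕ∞)) :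
    ∃ (C' : Fin T → MvPolynomial (Fin k × Fin (d + 1)) F)
      (R : Fin T → Fin k × Fin (d + 1) → MvPolynomial σ F),
      (∀ i j, (R i j).totalDegree ≤ d) ∧ P = ∑ i, aeval (R i) (C' i) := by
  classical
  choose B hB using fun i => exists_isTransBasisOfSet (Set.range (Q i))
  have hcard : ∀ i, (B i).encard ≤ k := fun i => by
    rw [← algebraicRank_eq_encard (hB i)]; exact hrank i
  choose f hf using fun i => exists_fun_range_of_encard_le (hcard i)
  have halg : ∀ i j, IsAlgebraic (Algebra.adjoin F (B i)) (Q i j) := fun i j =>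
    (AlgebraicIndependent.matroid_isBasis_iff.1 (hB i).isBasis).2.2 _ ⟨j, rfl⟩
  choose p hp hp' using fun i j => exists_simple_root (halg i j)
  -- One point serves all `i` and `j`: a nonzero product over an infinite field has a nonvanishing
  -- value.
  obtain ⟨a, ha⟩ : ∃ a, eval a (∏ i, ∏ j,
      Polynomial.aeval (Q i j) (p i j).derivative : MvPolynomial σ F) ≠ 0 := by
    by_contra! h
    have : (∏ i, ∏ j, Polynomial.aeval (Q i j) (p i j).derivative : MvPolynomial σ F) = 0 :=
      MvPolynomial.funext fun x => by rw [h x, map_zero]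
    exact Finset.prod_ne_zero_iff.2 (fun i _ => Finset.prod_ne_zero_iff.2 fun j _ => hp' i j) this
  have ha' : ∀ i j, eval a (Polynomial.aeval (Q i j) (p i j).derivative) ≠ 0 := by
    intro i j
    rw [map_prod] at ha
    have := Finset.prod_ne_zero_iff.1 ha i (Finset.mem_univ _)
    rw [map_prod] at this
    exact Finset.prod_ne_zero_iff.1 this j (Finset.mem_univ _)
  set R : Fin T → Fin k × Fin (d + 1) → MvPolynomial σ F := fun i x =>
    homogeneousComponent x.2 (translateVars a (f i x.1)) with hR
  have hhom : ∀ i, ∀ g ∈ Set.range (R i), ∃ n, g.IsHomogeneous n := by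
    rintro i _ ⟨x, rfl⟩
    exact ⟨_, homogeneousComponent_isHomogeneous _ _⟩
  have hBd : ∀ i, ∀ b ∈ B i, b.totalDegree ≤ d := by
    intro i b hb
    obtain ⟨j, rfl⟩ := (hB i).prop.1 hb
    exact hdeg i j
  have hBmem : ∀ i, ∀ b ∈ B i, translateVars a b ∈ Algebra.adjoin F (Set.range (R i)) := by
    intro i b hb
    obtain ⟨x, rfl⟩ := hf i hb
    rw [← sum_homogeneousComponent (translateVars a (f i x))]
    refine Subalgebra.sum_mem _ fun r hr => Algebra.subset_adjoin ?_
    have h1 := (totalDegree_translateVars_le a (f i x)).trans (hBd i _ hb)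
    rw [Finset.mem_range] at hr
    exact ⟨(x, ⟨r, by omega⟩), rfl⟩
  have hQmem : ∀ i j, translateVars a (Q i j) ∈ Algebra.adjoin F (Set.range (R i)) := fun i j =>
    translateVars_mem_adjoin (hhom i) (hBmem i) (hp i j) (ha' i j)
  have hmem : ∀ i, homogeneousComponent Δ (translateVars a (aeval (Q i) (C i))) ∈
      Algebra.adjoin F (Set.range (R i)) := by
    intro i
    refine homogeneousComponent_mem_adjoin (hhom i) ?_ _
    have : aeval (Q i) (C i) ∈ Algebra.adjoin F (Set.range (Q i)) := by
      rw [Algebra.adjoin_range_eq_range_aeval]; exact ⟨_, rfl⟩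
    have hle : Algebra.adjoin F (Set.range (Q i)) ≤
        (Algebra.adjoin F (Set.range (R i))).comap (translateVars a) :=
      Algebra.adjoin_le (by rintro _ ⟨j, rfl⟩; exact hQmem i j)
    exact hle this
  simp_rw [Algebra.adjoin_range_eq_range_aeval] at hmem
  choose C' hC' using hmem
  refine ⟨C', R, fun i x => ?_, ?_⟩
  · exact (homogeneousComponent_isHomogeneous _ _).totalDegree_le.trans (by omega)
  · rw [← homogeneousComponent_translateVars a hP, hrep, map_sum, map_sum]
    exact Finset.sum_congr rfl fun i _ => (hC' i).symm

/-! ### Partial derivatives of compositions. -/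

theorem pderiv_pderiv_comm {σ F : Type*} [Field F] (i j : σ) (p : MvPolynomial σ F) :
    pderiv i (pderiv j p) = pderiv j (pderiv i p) := by
  classical
  ext m
  rw [coeff_pderiv, coeff_pderiv, coeff_pderiv, coeff_pderiv, add_right_comm]
  by_cases h : i = j
  · rw [h]
  · rw [Finsupp.add_apply, Finsupp.add_apply, Finsupp.single_eq_of_ne (Ne.symm h),
      Finsupp.single_eq_of_ne h]
    ring_nf

theorem totalDegree_pderiv_le {σ F : Type*} [Field F] (i : σ) (p : MvPolynomial σ F) :
    (pderiv i p).totalDegree ≤ p.totalDegree - 1 := by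
  classical
  refine Finset.sup_le fun s hs => ?_
  have h : s + Finsupp.single i 1 ∈ p.support := by
    rw [mem_support_iff, coeff_pderiv] at hs
    exact mem_support_iff.2 (left_ne_zero_of_mul hs)
  have h2 := le_totalDegree h
  have h3 : ((s + Finsupp.single i 1).sum fun _ e => e) = (s.sum fun _ e => e) + 1 := by
    rw [Finsupp.sum_add_index' (by simp) (by simp), Finsupp.sum_single_index rfl]
  show (s.sum fun _ e => e) ≤ _
  omega

theorem pderiv_aeval {σ ι F : Type*} [Field F] [Fintype ι] (R : ι → MvPolynomial σ F)
    (i : σ) (C : MvPolynomial ι F) :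
    pderiv i (aeval R C) = ∑ j, pderiv i (R j) * aeval R (pderiv j C) := by
  classical
  induction C using MvPolynomial.induction_on with
  | C a => simp
  | add p q hp hq => simp only [map_add, hp, hq, mul_add, Finset.sum_add_distrib]
  | mul_X p j hp =>
    have : ∀ x, pderiv i (R x) * aeval R (pderiv x (p * X j)) =
        (pderiv i (R x) * aeval R (pderiv x p)) * R j +
          (if x = j then aeval R p * pderiv i (R x) else 0) := by
      intro x
      rw [pderiv_mul, pderiv_X, Pi.single_apply]
      by_cases h : x = j
      · simp [h]; ring
      · simp [h, Ne.symm h]; ring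
    rw [map_mul, pderiv_mul, hp, aeval_X]
    simp_rw [this]
    rw [Finset.sum_add_distrib, ← Finset.sum_mul, Finset.sum_ite_eq' Finset.univ j]
    simp

/-- The partial derivative in the direction of a variable, or the identity. -/
noncomputable def optionPDeriv {ι F : Type*} [Field F] (o : Option ι) (p : MvPolynomial ι F) :
    MvPolynomial ι F :=
  o.elim p fun i => pderiv i p

/-- This lets derivatives be indexed by multisets rather than words, so they are counted by a
binomial coefficient; `none` pads orders below `l`. -/
instance {ι F : Type*} [Field F] : LeftCommutative (optionPDeriv (ι := ι) (F := F)) where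
  left_comm a b p := by
    cases a <;> cases b <;> simp [optionPDeriv, pderiv_pderiv_comm]

/-- The span of the compositions with `R` of the partial derivatives of `C` of order at most `l`. -/
noncomputable def compDerivSpan {σ ι F : Type*} [Field F] (R : ι → MvPolynomial σ F)
    (C : MvPolynomial ι F) (l : ℕ) : Submodule F (MvPolynomial σ F) :=
  Submodule.span F (Set.range fun s : Sym (Option ι) l =>
    aeval R ((s : Multiset (Option ι)).foldr optionPDeriv C))

theorem mem_compDerivSpan_succ {σ ι F : Type*} [Field F] {R : ι → MvPolynomial σ F}
    {C : MvPolynomial ι F} {l : ℕ} (o : Option ι) (s : Sym (Option ι) l) :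
    aeval R (optionPDeriv o ((s : Multiset (Option ι)).foldr optionPDeriv C)) ∈
      compDerivSpan R C (l + 1) := by
  refine Submodule.subset_span ⟨o ::ₛ s, ?_⟩
  simp only [Sym.coe_cons, Multiset.foldr_cons]

theorem compDerivSpan_le_succ {σ ι F : Type*} [Field F] {R : ι → MvPolynomial σ F}
    {C : MvPolynomial ι F} {l : ℕ} : compDerivSpan R C l ≤ compDerivSpan R C (l + 1) := by
  refine Submodule.span_le.2 ?_
  rintro _ ⟨s, rfl⟩
  exact mem_compDerivSpan_succ none s

theorem pderiv_mem_of_mem_compDerivSpan {σ ι F : Type*} [Field F] [Fintype ι]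
    {R : ι → MvPolynomial σ F} {d : ℕ} (hR : ∀ j, (R j).totalDegree ≤ d) {C : MvPolynomial ι F}
    {l : ℕ} (i : σ) {g : MvPolynomial σ F} (hg : g ∈ compDerivSpan R C l) :
    pderiv i g ∈ restrictTotalDegree σ F (d - 1) * compDerivSpan R C (l + 1) := by
  induction hg using Submodule.span_induction with
  | zero => simp
  | add x y _ _ hx hy => rw [map_add]; exact add_mem hx hy
  | smul a x _ hx => rw [Derivation.map_smul]; exact Submodule.smul_mem _ _ hx
  | mem x hx =>
    obtain ⟨s, rfl⟩ := hx
    simp only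
    rw [pderiv_aeval]
    refine Submodule.sum_mem _ fun j _ => Submodule.mul_mem_mul ?_ ?_
    · rw [mem_restrictTotalDegree]
      exact (totalDegree_pderiv_le _ _).trans (Nat.sub_le_sub_right (hR j) 1)
    · exact mem_compDerivSpan_succ (some j) s

theorem mul_mem_restrictTotalDegree {σ F : Type*} [Field F] {a b : ℕ} {p q : MvPolynomial σ F}
    (hp : p ∈ restrictTotalDegree σ F a) (hq : q ∈ restrictTotalDegree σ F b) :
    p * q ∈ restrictTotalDegree σ F (a + b) := by
  rw [mem_restrictTotalDegree] at *
  exact (totalDegree_mul _ _).trans (add_le_add hp hq)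

theorem mul_mem_restrictTotalDegree_mul {σ F : Type*} [Field F] {a b : ℕ}
    {W : Submodule F (MvPolynomial σ F)} {p g : MvPolynomial σ F}
    (hp : p ∈ restrictTotalDegree σ F a) (hg : g ∈ restrictTotalDegree σ F b * W) :
    p * g ∈ restrictTotalDegree σ F (a + b) * W := by
  induction hg using Submodule.mul_induction_on' with
  | mem_mul_mem q hq w hw =>
    rw [← mul_assoc]
    exact Submodule.mul_mem_mul (mul_mem_restrictTotalDegree hp hq) hw
  | add x _ y _ hx hy => rw [mul_add]; exact add_mem hx hy

/-- By the product and chain rules, one derivative raises the order on `C` by at most one and costs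
a factor `pderiv i (R j)`, of degree at most `d - 1`. -/
theorem pderiv_mem_of_mem_mul_compDerivSpan {σ ι F : Type*} [Field F] [Fintype ι]
    {R : ι → MvPolynomial σ F} {d : ℕ} (hR : ∀ j, (R j).totalDegree ≤ d) {C : MvPolynomial ι F}
    {l a : ℕ} (i : σ) {g : MvPolynomial σ F}
    (hg : g ∈ restrictTotalDegree σ F a * compDerivSpan R C l) :
    pderiv i g ∈ restrictTotalDegree σ F (a + (d - 1)) * compDerivSpan R C (l + 1) := by
  induction hg using Submodule.mul_induction_on' with
  | mem_mul_mem q hq w hw =>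
    rw [pderiv_mul]
    refine add_mem (Submodule.mul_mem_mul ?_ (compDerivSpan_le_succ hw))
      (mul_mem_restrictTotalDegree_mul hq (pderiv_mem_of_mem_compDerivSpan hR i hw))
    rw [mem_restrictTotalDegree] at *
    exact (totalDegree_pderiv_le _ _).trans (by omega)
  | add x _ y _ hx hy => rw [map_add]; exact add_mem hx hy

/-- The iterated partial derivative along a list of variables. -/
noncomputable def pderivList {σ F : Type*} [Field F] (L : List σ) (p : MvPolynomial σ F) :
    MvPolynomial σ F :=
  L.foldr (fun i q => pderiv i q) p

theorem pderivList_sum {σ F κ : Type*} [Field F] (L : List σ) (s : Finset κ)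
    (f : κ → MvPolynomial σ F) : pderivList L (∑ i ∈ s, f i) = ∑ i ∈ s, pderivList L (f i) := by
  induction L with
  | nil => rfl
  | cons i L ih =>
    show pderiv i (pderivList L _) = _
    rw [ih, map_sum]
    rfl

theorem pderivList_aeval_mem {σ ι F : Type*} [Field F] [Fintype ι]
    {R : ι → MvPolynomial σ F} {d : ℕ} (hR : ∀ j, (R j).totalDegree ≤ d) (C : MvPolynomial ι F)
    (L : List σ) : pderivList L (aeval R C) ∈
      restrictTotalDegree σ F (L.length * (d - 1)) * compDerivSpan R C L.length := by
  induction L with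
  | nil =>
    rw [← one_mul (pderivList _ _)]
    refine Submodule.mul_mem_mul ?_ (Submodule.subset_span ⟨Sym.nil, rfl⟩)
    simp [mem_restrictTotalDegree]
  | cons i L ih =>
    rw [List.length_cons, add_mul, one_mul]
    exact pderiv_mem_of_mem_mul_compDerivSpan hR i ih

/-- Each derivative multiplies a surviving coefficient by a positive integer, which is nonzero in
characteristic zero. -/
theorem coeff_pderivList {σ F : Type*} [Field F] [CharZero F] [DecidableEq σ] (L : List σ)
    (p : MvPolynomial σ F) (m : σ →₀ ℕ) :
    ∃ c : F, c ≠ 0 ∧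
      coeff m (pderivList L p) = c * coeff (m + Multiset.toFinsupp (L : Multiset σ)) p := by
  induction L generalizing m with
  | nil => exact ⟨1, one_ne_zero, by simp [pderivList]⟩
  | cons i L ih =>
    obtain ⟨c, hc, h⟩ := ih (m + Finsupp.single i 1)
    refine ⟨c * (m i + 1), mul_ne_zero hc (Nat.cast_add_one_ne_zero _), ?_⟩
    show coeff m (pderiv i (pderivList L p)) = _
    rw [coeff_pderiv, h, ← Multiset.cons_coe, ← Multiset.singleton_add, map_add,
      Multiset.toFinsupp_singleton, add_assoc]
    ring

/-! ### Linear independence and dimension count. -/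

/-- Polynomials with pairwise distinct trailing monomials are linearly independent. -/
theorem linearIndependent_of_trailing {σ F κ L : Type*} [Field F] [LinearOrder L]
    {φ : (σ →₀ ℕ) → L} (hφ : Function.Injective φ) {v : κ → MvPolynomial σ F}
    {e : κ → σ →₀ ℕ} (he : Function.Injective e) (h1 : ∀ i, coeff (e i) (v i) ≠ 0)
    (h2 : ∀ i, ∀ b, coeff b (v i) ≠ 0 → φ (e i) ≤ φ b) : LinearIndependent F v := by
  classical
  rw [linearIndependent_iff']
  intro s g hg
  by_contra! hne
  obtain ⟨j, hj, hgj⟩ := hne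
  obtain ⟨i, hi, hmin⟩ := (s.filter fun i => g i ≠ 0).exists_min_image (fun i => φ (e i))
    ⟨j, by simp [hj, hgj]⟩
  rw [Finset.mem_filter] at hi
  have h := congrArg (coeff (e i)) hg
  rw [coeff_sum, coeff_zero, Finset.sum_eq_single_of_mem i hi.1] at h
  · rw [coeff_smul, smul_eq_mul] at h
    exact (mul_ne_zero hi.2 (h1 i)) h
  · intro b hb hbi
    rw [coeff_smul, smul_eq_mul]
    by_contra hc
    have hb' := hmin b (by simp [hb, left_ne_zero_of_mul hc])
    have hb'' := h2 b _ (right_ne_zero_of_mul hc)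
    exact hbi (he (hφ (le_antisymm hb'' hb')))

theorem card_le_of_linearIndependent_of_mem_span {F V κ ν : Type*} [Field F] [AddCommGroup V]
    [Module F V] [Fintype κ] [Fintype ν] {v : κ → V} (hv : LinearIndependent F v) (u : ν → V)
    (h : ∀ i, v i ∈ Submodule.span F (Set.range u)) : Fintype.card κ ≤ Fintype.card ν := by
  have : Module.Finite F (Submodule.span F (Set.range u)) :=
    Module.Finite.span_of_finite F (Set.finite_range u)
  have hw : LinearIndependent F fun i => (⟨v i, h i⟩ : Submodule.span F (Set.range u)) :=
    LinearIndependent.of_comp (Submodule.span F (Set.range u)).subtype hv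
  exact hw.fintype_card_le_finrank.trans (finrank_range_le_card u)

/-- Exponent vectors of degree at most `m` correspond to multisets of size `m` on the variables
and one additional slack symbol. -/
noncomputable def symOptionEquiv (τ : Type*) [Fintype τ] [DecidableEq τ] (m : ℕ) :
    Sym (Option τ) m ≃ {e : τ →₀ ℕ // e.degree ≤ m} := by
  have key : ∀ s : Sym (Option τ) m, (Multiset.toFinsupp (s : Multiset (Option τ))) none +
      (Multiset.toFinsupp (s : Multiset (Option τ))).some.degree = m := by
    intro s
    have h := Multiset.toFinsupp_sum_eq (s : Multiset (Option τ))
    rw [Finsupp.sum_fintype _ _ (by simp), Fintype.sum_option] at h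
    rw [Finsupp.degree_eq_sum]
    exact h.trans s.2
  refine Equiv.ofBijective (fun s => ⟨(Multiset.toFinsupp (s : Multiset (Option τ))).some, ?_⟩) ⟨?_, ?_⟩
  · have := key s
    omega
  · intro s t hst
    have hst' := Subtype.ext_iff.1 hst
    simp only at hst'
    apply Sym.coe_injective
    apply Multiset.toFinsupp.injective
    ext o
    cases o with
    | none =>
      have h1 := key s
      have h2 := key t
      rw [hst'] at h1
      omega
    | some i => exact DFunLike.congr_fun hst' i
  · rintro ⟨e, he⟩
    refine ⟨⟨Finsupp.toMultiset (e.optionElim (m - e.degree)), ?_⟩, ?_⟩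
    · rw [Finsupp.card_toMultiset, Finsupp.sum_fintype _ _ (by simp), Fintype.sum_option]
      simp only [Finsupp.optionElim_apply_none, Finsupp.optionElim_apply_some, id]
      rw [← Finsupp.degree_eq_sum]
      omega
    · apply Subtype.ext
      simp

noncomputable instance (τ : Type*) [Fintype τ] (m : ℕ) : Fintype {e : τ →₀ ℕ // e.degree ≤ m} := by
  classical
  exact Fintype.ofEquiv _ (symOptionEquiv τ m)

theorem card_degree_le (τ : Type*) [Fintype τ] (m : ℕ) :
    Fintype.card {e : τ →₀ ℕ // e.degree ≤ m} = (Fintype.card τ + m).choose m := by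
  classical
  rw [← Fintype.card_congr (symOptionEquiv τ m), Sym.card_sym_eq_choose, Fintype.card_option]
  congr 1
  omega

theorem restrictTotalDegree_le_span {σ F : Type*} [Field F] (D : ℕ) :
    restrictTotalDegree σ F D ≤ Submodule.span F
      (Set.range fun e : {e : σ →₀ ℕ // e.degree ≤ D} => monomial e.1 (1 : F)) := by
  intro p hp
  rw [mem_restrictTotalDegree] at hp
  rw [p.as_sum]
  refine Submodule.sum_mem _ fun s hs => ?_
  rw [← mul_one (coeff s p), ← smul_eq_mul, ← smul_monomial]
  refine Submodule.smul_mem _ _ (Submodule.subset_span ⟨⟨s, ?_⟩, rfl⟩)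
  exact (le_totalDegree hs).trans hp

theorem mul_compDerivSpan_le_span {σ ι F : Type*} [Field F] (R : ι → MvPolynomial σ F)
    (C : MvPolynomial ι F) (D l : ℕ) :
    restrictTotalDegree σ F D * compDerivSpan R C l ≤ Submodule.span F
      (Set.range fun x : {e : σ →₀ ℕ // e.degree ≤ D} × Sym (Option ι) l =>
        monomial x.1.1 (1 : F) * aeval R ((x.2 : Multiset (Option ι)).foldr optionPDeriv C)) := by
  refine (mul_le_mul_left (restrictTotalDegree_le_span D) _).trans ?_
  rw [compDerivSpan, Submodule.span_mul_span]
  refine Submodule.span_mono ?_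
  rintro _ ⟨_, ⟨e, rfl⟩, _, ⟨s, rfl⟩, rfl⟩
  exact ⟨(e, s), rfl⟩

/-- The counting inequality behind the shifted partial derivative method: all variables occur in
the trailing monomial `α` of a sum of `T` compositions. -/
theorem choose_mul_choose_le_of_trailing {σ ι F L : Type*} [Field F] [CharZero F] [Fintype σ]
    [Fintype ι] [AddCommMonoid L] [LinearOrder L] [IsOrderedCancelAddMonoid L]
    (φ : (σ →₀ ℕ) →+ L) (hφ : Function.Injective φ) {T d : ℕ} (R : Fin T → ι → MvPolynomial σ F)
    (hR : ∀ i j, (R i j).totalDegree ≤ d) (C : Fin T → MvPolynomial ι F)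
    {P : MvPolynomial σ F} (hP : P = ∑ i, aeval (R i) (C i)) {α : σ →₀ ℕ} (hα : ∀ i, α i ≠ 0)
    (hαP : coeff α P ≠ 0) (hmin : ∀ β, coeff β P ≠ 0 → φ α ≤ φ β) (l m : ℕ) :
    (Fintype.card σ).choose l * (Fintype.card σ - l + m).choose m ≤
      T * ((Fintype.card σ + (l * (d - 1) + m)).choose (l * (d - 1) + m) *
        (Fintype.card ι + l).choose l) := by
  classical
  let ind : Finset σ → σ →₀ ℕ := fun B => Multiset.toFinsupp B.val
  have ind_apply : ∀ B i, ind B i = if i ∈ B then 1 else 0 := fun B i => by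
    show Multiset.count i B.val = _
    rw [Multiset.count_eq_of_nodup B.nodup]
    rfl
  have ind_le : ∀ B, ind B ≤ α := fun B i => by
    rw [ind_apply]
    have := hα i
    split_ifs <;> omega
  -- The shifts avoid the variables in `B`; this makes `B` recoverable from the trailing monomial.
  let κ := (B : {B : Finset σ // B ∈ Finset.powersetCard l Finset.univ}) ×
    {e : {i // i ∉ B.1} →₀ ℕ // e.degree ≤ m}
  let c : κ → σ →₀ ℕ := fun x => x.2.1.mapDomain Subtype.val
  have c_apply : ∀ x : κ, ∀ i (h : i ∉ x.1.1), c x i = x.2.1 ⟨i, h⟩ := fun x i h =>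
    Finsupp.mapDomain_apply Subtype.val_injective x.2.1 ⟨i, h⟩
  have c_zero : ∀ x : κ, ∀ i, i ∈ x.1.1 → c x i = 0 := fun x i h =>
    Finsupp.mapDomain_of_notMem_range _ _ (by simpa using h)
  let v : κ → MvPolynomial σ F := fun x =>
    monomial (c x) 1 * pderivList x.1.1.toList P
  let e : κ → σ →₀ ℕ := fun x => c x + (α - ind x.1.1)
  have coeff_v : ∀ (x : κ) γ, ∃ a : F, a ≠ 0 ∧
      coeff (c x + γ) (v x) = a * coeff (γ + ind x.1.1) P := by
    intro x γ
    obtain ⟨a, ha, h⟩ := coeff_pderivList x.1.1.toList P γ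
    refine ⟨a, ha, ?_⟩
    rw [Finset.coe_toList] at h
    rw [coeff_monomial_mul, one_mul, h]
  have e_apply : ∀ x i, e x i = if i ∈ x.1.1 then α i - 1 else α i + c x i := by
    intro x i
    show c x i + (α i - ind x.1.1 i) = _
    rw [ind_apply]
    split_ifs with h
    · rw [c_zero x i h, zero_add]
    · rw [add_comm, Nat.sub_zero]
  have he : Function.Injective e := by
    -- The exponent drops below that of `α` exactly on `B`; off `B` the excess over `α` is the
    -- shift.
    have hB : ∀ x i, i ∈ x.1.1 ↔ e x i < α i := by
      intro x i
      have := hα i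
      rw [e_apply]
      split_ifs with h
      · exact ⟨fun _ => by omega, fun _ => h⟩
      · exact ⟨fun h' => absurd h' h, fun h' => by omega⟩
    rintro x y hxy
    have h1 : x.1 = y.1 := Subtype.ext (Finset.ext fun i => by rw [hB, hB, hxy])
    obtain ⟨B, u, hu⟩ := x
    obtain ⟨B', w, hw⟩ := y
    simp only at h1
    subst h1
    congr 2
    ext ⟨i, hi⟩
    have := DFunLike.congr_fun hxy i
    rw [e_apply, e_apply, if_neg hi, if_neg hi, c_apply _ i hi, c_apply _ i hi] at this
    exact Nat.add_left_cancel this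
  have hli : LinearIndependent F v := by
    refine linearIndependent_of_trailing hφ he (fun x => ?_) fun x b hb => ?_
    · obtain ⟨a, ha, h⟩ := coeff_v x (α - ind x.1.1)
      rw [tsub_add_cancel_of_le (ind_le _)] at h
      rw [h]
      exact mul_ne_zero ha hαP
    · have hcb : c x ≤ b := by
        by_contra hcb
        rw [coeff_monomial_mul', if_neg hcb] at hb
        exact hb rfl
      obtain ⟨γ, rfl⟩ := exists_add_of_le hcb
      obtain ⟨a, ha, h⟩ := coeff_v x γ
      rw [h] at hb
      -- Monomials of the derivative come from monomials of `P` by removing `ind x.1.1`, which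
      -- cancels in the order.
      have h1 := hmin _ (right_ne_zero_of_mul hb)
      rw [← tsub_add_cancel_of_le (ind_le x.1.1), map_add, map_add] at h1
      rw [map_add, map_add]
      exact add_le_add_right (le_of_add_le_add_right h1) _
  have hspan : ∀ x, v x ∈ Submodule.span F (Set.range
      fun y : Fin T × {e : σ →₀ ℕ // e.degree ≤ l * (d - 1) + m} × Sym (Option ι) l =>
        monomial y.2.1.1 (1 : F) *
          aeval (R y.1) ((y.2.2 : Multiset (Option ι)).foldr optionPDeriv (C y.1))) := by
    intro x
    show monomial (c x) 1 * pderivList x.1.1.toList P ∈ _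
    rw [hP, pderivList_sum, Finset.mul_sum]
    refine Submodule.sum_mem _ fun i _ => ?_
    have hc : monomial (c x) (1 : F) ∈ restrictTotalDegree σ F m := by
      rw [mem_restrictTotalDegree, totalDegree_monomial _ one_ne_zero]
      exact (Finsupp.degree_mapDomain _ _).le.trans x.2.2
    have h1 := mul_mem_restrictTotalDegree_mul hc (pderivList_aeval_mem (hR i) (C i) x.1.1.toList)
    rw [Finset.length_toList, (Finset.mem_powersetCard.1 x.1.2).2, add_comm m] at h1
    refine Submodule.span_mono ?_ (mul_compDerivSpan_le_span _ _ _ _ h1)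
    rintro _ ⟨y, rfl⟩
    exact ⟨(i, y), rfl⟩
  have hcard := card_le_of_linearIndependent_of_mem_span hli _ hspan
  have hκ : Fintype.card κ = (Fintype.card σ).choose l * (Fintype.card σ - l + m).choose m := by
    rw [Fintype.card_sigma, Finset.sum_congr rfl (g := fun _ =>
      (Fintype.card σ - l + m).choose m), Finset.sum_const, Finset.card_univ, Fintype.card_coe,
      Finset.card_powersetCard, Finset.card_univ, smul_eq_mul]
    intro B _
    rw [card_degree_le, Fintype.card_subtype_compl, Fintype.card_coe,
      (Finset.mem_powersetCard.1 B.2).2]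
  rw [hκ, Fintype.card_prod, Fintype.card_prod, Fintype.card_fin, card_degree_le,
    Sym.card_sym_eq_choose, Fintype.card_option] at hcard
  refine hcard.trans (le_of_eq ?_)
  congr 4
  omega

/-! ### Numerical estimates. -/

theorem pow_le_pow_mul_choose {N l : ℕ} (h : l ≤ N) : N ^ l ≤ l ^ l * N.choose l := by
  induction l generalizing N with
  | zero => simp
  | succ l ih =>
    obtain ⟨M, rfl⟩ : ∃ M, N = M + 1 := ⟨N - 1, by omega⟩
    rcases Nat.eq_zero_or_pos l with rfl | hl
    · simp
    have h1 := ih (N := M) (by omega)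
    have h2 := Nat.add_one_mul_choose_eq M l
    have h3 : (M + 1) ^ l * l ^ l ≤ (l + 1) ^ l * M ^ l := by
      rw [← mul_pow, ← mul_pow]
      exact Nat.pow_le_pow_left (by nlinarith) l
    have h4 : (M + 1) ^ l ≤ (l + 1) ^ l * M.choose l := by
      refine Nat.le_of_mul_le_mul_right (c := l ^ l) ?_ (Nat.pow_pos hl)
      calc _ ≤ (l + 1) ^ l * M ^ l := h3
        _ ≤ (l + 1) ^ l * (l ^ l * M.choose l) := Nat.mul_le_mul_left _ h1
        _ = _ := by ring
    calc (M + 1) ^ (l + 1) = (M + 1) * (M + 1) ^ l := by ring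
      _ ≤ (M + 1) * ((l + 1) ^ l * M.choose l) := Nat.mul_le_mul_left _ h4
      _ = (l + 1) ^ l * ((M + 1) * M.choose l) := by ring
      _ = _ := by rw [h2]; ring

/-- The factors `(N + m + i) / (m + i)` for `1 ≤ i ≤ j` are each at most `(N + m) / m`; the form
without division allows `m = 0`. -/
theorem factorial_add_mul_pow_le (N m j : ℕ) :
    (N + m + j).factorial * m.factorial * m ^ j ≤
      (N + m).factorial * (m + j).factorial * (N + m) ^ j := by
  induction j with
  | zero => simp
  | succ j ih =>
    have h : (N + m + j + 1) * m ≤ (m + j + 1) * (N + m) := by nlinarith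
    calc _ = ((N + m + j + 1) * m) * ((N + m + j).factorial * m.factorial * m ^ j) := by
          rw [← add_assoc, Nat.factorial_succ]; ring
      _ ≤ ((m + j + 1) * (N + m)) * ((N + m).factorial * (m + j).factorial * (N + m) ^ j) :=
          Nat.mul_le_mul h ih
      _ = _ := by rw [← add_assoc m, Nat.factorial_succ]; ring

theorem succ_pow_le_exp_mul_pow (d : ℕ) :
    ((d : ℝ) + 1) ^ d ≤ Real.exp 1 * (d : ℝ) ^ d := by
  rcases Nat.eq_zero_or_pos d with rfl | hd
  · simp
  have hd' : (0 : ℝ) < d := by exact_mod_cast hd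
  have h1 : ((d : ℝ)⁻¹ + 1) ^ d ≤ Real.exp 1 := by
    calc _ ≤ (Real.exp (d : ℝ)⁻¹) ^ d :=
          pow_le_pow_left₀ (by positivity) (Real.add_one_le_exp _) d
      _ = _ := by rw [← Real.exp_nat_mul, mul_inv_cancel₀ hd'.ne']
  calc ((d : ℝ) + 1) ^ d = ((d : ℝ)⁻¹ + 1) ^ d * (d : ℝ) ^ d := by
        rw [← mul_pow]; congr 1; field_simp; ring
    _ ≤ _ := by gcongr

/-- With `m = N * d` the ratio `(N + m) / m` is `(d + 1) / d`, whose power `l * d` is at most `e ^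
l`. The factor `(N * (d + 1)) ^ l` bounds the product of the top `l` factors of `(N + N * d)!`. -/
theorem factorial_mul_factorial_le {N l : ℕ} (d : ℕ) (hN : 0 < N) (hl : l ≤ N) :
    ((N + (l * d + N * d)).factorial : ℝ) * (N * d).factorial ≤
      (N - l + N * d).factorial * (l * d + N * d).factorial *
        ((N : ℝ) * (d + 1) * Real.exp 1) ^ l := by
  have h1 := factorial_add_mul_pow_le N (N * d) (l * d)
  have h2 : (N + N * d).factorial ≤ (N - l + N * d).factorial * (N + N * d) ^ l := by
    have h := Nat.factorial_mul_descFactorial (n := N + N * d) (k := l) (by omega)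
    rw [← h, show N + N * d - l = N - l + N * d by omega]
    exact Nat.mul_le_mul_left _ (Nat.descFactorial_le_pow _ _)
  rw [show N + N * d + l * d = N + (l * d + N * d) by ring, show N * d + l * d = l * d + N * d by
    ring] at h1
  have h3 : ((N + (l * d + N * d)).factorial : ℝ) * (N * d).factorial * ((N : ℝ) * d) ^ (l * d) ≤
      ((N - l + N * d).factorial * (N + (N : ℝ) * d) ^ l) * (l * d + N * d).factorial *
        (N + (N : ℝ) * d) ^ (l * d) := by
    have h1' : ((N + (l * d + N * d)).factorial : ℝ) * (N * d).factorial * ((N : ℝ) * d) ^ (l * d) ≤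
      (N + N * d).factorial * (l * d + N * d).factorial * (N + (N : ℝ) * d) ^ (l * d) := by
      exact_mod_cast h1
    have h2' : ((N + N * d).factorial : ℝ) ≤ (N - l + N * d).factorial * (N + (N : ℝ) * d) ^ l := by
      exact_mod_cast h2
    refine h1'.trans ?_
    gcongr
  have hN' : (0 : ℝ) < N := by exact_mod_cast hN
  have hdd : (0 : ℝ) < (d : ℝ) ^ d := by
    rcases Nat.eq_zero_or_pos d with rfl | hd
    · simp
    · positivity
  have hpos : (0 : ℝ) < ((N : ℝ) * d) ^ (l * d) := by
    rw [mul_pow, mul_comm l d, pow_mul (d : ℝ)]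
    positivity
  refine le_of_mul_le_mul_right (h3.trans ?_) hpos
  have h4 : ((d : ℝ) + 1) ^ (l * d) ≤ Real.exp 1 ^ l * (d : ℝ) ^ (l * d) := by
    rw [mul_comm l d, pow_mul, pow_mul, ← mul_pow]
    exact pow_le_pow_left₀ (by positivity) (succ_pow_le_exp_mul_pow d) l
  calc _ = ((N - l + N * d).factorial * (l * d + N * d).factorial * (N + (N : ℝ) * d) ^ l *
        (N : ℝ) ^ (l * d)) * ((d : ℝ) + 1) ^ (l * d) := by
        rw [show (N + (N : ℝ) * d) ^ (l * d) = (N : ℝ) ^ (l * d) * ((d : ℝ) + 1) ^ (l * d) by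
          rw [← mul_pow]; ring]
        ring
    _ ≤ ((N - l + N * d).factorial * (l * d + N * d).factorial * (N + (N : ℝ) * d) ^ l *
        (N : ℝ) ^ (l * d)) * (Real.exp 1 ^ l * (d : ℝ) ^ (l * d)) := by gcongr
    _ = _ := by
        rw [show N + (N : ℝ) * d = N * (d + 1) by ring]
        simp only [mul_pow]
        ring

/-- Combine `N.choose l ≥ (N / l) ^ l` with `l! ≥ (l / e) ^ l`; the hypothesis then replaces one
factor `N / l`. -/
theorem pow_le_choose_sq_mul_factorial {N l d : ℕ} (hl : l ≤ N)
    (h : 2 * Real.exp 1 ^ 3 * (d + 1) * l ≤ N) :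
    (2 * Real.exp 1 ^ 2 * (d + 1) * N) ^ l ≤ (N.choose l : ℝ) ^ 2 * l.factorial := by
  rcases Nat.eq_zero_or_pos l with rfl | hl0
  · simp
  have hl0' : (0 : ℝ) < l := by exact_mod_cast hl0
  have h1 : (N : ℝ) ^ l ≤ (l : ℝ) ^ l * N.choose l := by exact_mod_cast pow_le_pow_mul_choose hl
  have h2 : (l : ℝ) ^ l ≤ Real.exp 1 ^ l * l.factorial := by
    have := Real.pow_div_factorial_le_exp (l : ℝ) hl0'.le l
    rw [div_le_iff₀ (by positivity)] at this
    rwa [← Real.exp_nat_mul, mul_one]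
  have hE : (0 : ℝ) < Real.exp 1 ^ l := by positivity
  refine le_of_mul_le_mul_right (a := (l : ℝ) ^ l * (l : ℝ) ^ l * Real.exp 1 ^ l) ?_ (by positivity)
  calc _ = ((2 * Real.exp 1 ^ 3 * (d + 1) * l) * N) ^ l * (l : ℝ) ^ l := by
        simp only [mul_pow]; ring
    _ ≤ ((N : ℝ) * N) ^ l * (l : ℝ) ^ l := by gcongr
    _ = (N : ℝ) ^ l * (N : ℝ) ^ l * (l : ℝ) ^ l := by rw [mul_pow]
    _ ≤ ((l : ℝ) ^ l * N.choose l) * ((l : ℝ) ^ l * N.choose l) *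
          (Real.exp 1 ^ l * l.factorial) := by gcongr
    _ = _ := by ring

/-- The margin `(2 * e) ^ l` is what the final count needs: `2 ^ l` and `e ^ l` absorb the number of
derivatives and `T`. This and the two losses of `e` above produce the constant `2 * e ^ 3`. -/
theorem pow_mul_choose_le_choose_mul_choose {N l d : ℕ} (hN : 0 < N) (hl : l ≤ N)
    (h : 2 * Real.exp 1 ^ 3 * (d + 1) * l ≤ N) :
    (2 * Real.exp 1) ^ l * ((N + (l * d + N * d)).choose (l * d + N * d) : ℝ) ≤
      (N.choose l : ℝ) * (N - l + N * d).choose (N * d) := by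
  have h1 := factorial_mul_factorial_le d hN hl
  have h2 := pow_le_choose_sq_mul_factorial hl h
  set D := l * d + N * d
  have e1 : ((N + D).choose D : ℝ) * N.factorial * D.factorial = (N + D).factorial := by
    have := Nat.add_choose_mul_factorial_mul_factorial N D
    exact_mod_cast this
  have e2 : ((N - l + N * d).choose (N * d) : ℝ) * (N - l).factorial * (N * d).factorial =
      (N - l + N * d).factorial := by
    have := Nat.add_choose_mul_factorial_mul_factorial (N - l) (N * d)
    exact_mod_cast this
  have e3 : (N.choose l : ℝ) * l.factorial * (N - l).factorial = N.factorial := by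
    exact_mod_cast Nat.choose_mul_factorial_mul_factorial hl
  rw [← e1, ← e2] at h1
  have hpos : (0 : ℝ) < N.factorial * D.factorial * (N * d).factorial := by positivity
  refine le_of_mul_le_mul_right ?_ hpos
  calc _ = (2 * Real.exp 1) ^ l * (((N + D).choose D : ℝ) * N.factorial * D.factorial *
        (N * d).factorial) := by ring
    _ ≤ (2 * Real.exp 1) ^ l * (((N - l + N * d).choose (N * d) : ℝ) * (N - l).factorial *
        (N * d).factorial * D.factorial * ((N : ℝ) * (d + 1) * Real.exp 1) ^ l) := by gcongr
    _ = (2 * Real.exp 1 ^ 2 * (d + 1) * N) ^ l * (((N - l + N * d).choose (N * d) : ℝ) *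
        (N - l).factorial * (N * d).factorial * D.factorial) := by
        simp only [mul_pow]; ring
    _ ≤ ((N.choose l : ℝ) ^ 2 * l.factorial) * (((N - l + N * d).choose (N * d) : ℝ) *
        (N - l).factorial * (N * d).factorial * D.factorial) := by gcongr
    _ = (N.choose l : ℝ) * (N - l + N * d).choose (N * d) * ((N.choose l : ℝ) * l.factorial *
        (N - l).factorial * D.factorial * (N * d).factorial) := by ring
    _ = _ := by rw [e3]

/-- The choice of the parameters in the shifted partial derivative method. -/
theorem le_of_forall_choose_mul_choose_le {N n T d : ℕ} (hT : 0 < T)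
    (h : ∀ l m, N.choose l * (N - l + m).choose m ≤
      T * ((N + (l * d + m)).choose (l * d + m) * (n + l).choose l)) :
    (N : ℝ) ≤ 2 * Real.exp 1 ^ 3 * (d + 1) * (Real.log T + n * Real.log (2 * n) + 1) := by
  by_contra! hlt
  set L := Real.log T + n * Real.log (2 * n) + 1 with hL
  have hT' : (1 : ℝ) ≤ T := by exact_mod_cast hT
  have hlog : n * Real.log 2 ≤ n * Real.log (2 * n) := by
    rcases Nat.eq_zero_or_pos n with rfl | hn
    · simp
    · have : (1 : ℝ) ≤ n := by exact_mod_cast hn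
      gcongr
      linarith
  have hnn : 0 ≤ n * Real.log 2 := by positivity
  have hL1 : 1 ≤ L := by linarith [Real.log_nonneg hT']
  -- The `+ 1` in `L` covers rounding: `l` still exceeds `log T + n * log 2`, so `T * 2 ^ n < e ^
  -- l`.
  set l := ⌊L⌋₊ with hl
  have hlL : (l : ℝ) ≤ L := Nat.floor_le (by linarith)
  have hLl : L < l + 1 := Nat.lt_floor_add_one L
  have hE : 1 ≤ Real.exp 1 := Real.one_le_exp (by norm_num)
  have hE3 : 1 ≤ 2 * Real.exp 1 ^ 3 * (d + 1) := by
    have h1 := one_le_pow₀ hE (n := 3)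
    have h2 : (0 : ℝ) ≤ d := by positivity
    nlinarith
  have hb : 2 * Real.exp 1 ^ 3 * (d + 1) * l ≤ N :=
    (mul_le_mul_of_nonneg_left hlL (by positivity)).trans hlt.le
  have hlN : l ≤ N := by
    have : (l : ℝ) ≤ N := le_trans (le_mul_of_one_le_left (by positivity) hE3) hb
    exact_mod_cast this
  have hN : 0 < N := by
    have : (0 : ℝ) < N := lt_of_le_of_lt (by positivity) hlt
    exact_mod_cast this
  have h1 := pow_mul_choose_le_choose_mul_choose hN hlN hb
  have h2 : (N.choose l : ℝ) * (N - l + N * d).choose (N * d) ≤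
      T * ((N + (l * d + N * d)).choose (l * d + N * d) * (n + l).choose l) := by
    exact_mod_cast h l (N * d)
  have h3 : ((n + l).choose l : ℝ) ≤ 2 ^ n * 2 ^ l := by
    rw [← pow_add]; exact_mod_cast Nat.choose_le_two_pow _ _
  have h4 : (T : ℝ) * 2 ^ n < Real.exp 1 ^ l := by
    rw [← Real.exp_nat_mul, mul_one, ← Real.log_lt_iff_lt_exp (by positivity),
      Real.log_mul (by positivity) (by positivity), Real.log_pow]
    linarith
  have hpos : (0 : ℝ) < (N + (l * d + N * d)).choose (l * d + N * d) := by
    exact_mod_cast Nat.choose_pos (by omega)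
  set K : ℝ := Nat.cast ((N + (l * d + N * d)).choose (l * d + N * d))
  have : (2 * Real.exp 1) ^ l * K < (2 * Real.exp 1) ^ l * K := by
    calc _ ≤ T * (K * (n + l).choose l) := h1.trans h2
      _ ≤ T * (K * (2 ^ n * 2 ^ l)) := by gcongr
      _ = (T * 2 ^ n) * (2 ^ l * K) := by ring
      _ < Real.exp 1 ^ l * (2 ^ l * K) := by gcongr
      _ = _ := by rw [mul_pow]; ring
  exact lt_irrefl _ this

/-! ### Restriction to the support and conclusion. -/

theorem exists_isTrailingMonomial {σ F : Type*} [Field F] (m : MonomialOrder σ)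
    {P : MvPolynomial σ F} (hP : P ≠ 0) : ∃ α, IsTrailingMonomial m P α :=
  P.support.exists_min_image m.toSyn (support_nonempty.2 hP)

theorem totalDegree_killCompl_le {σ τ F : Type*} [Field F] {f : σ → τ}
    (hf : Function.Injective f) (p : MvPolynomial τ F) :
    (killCompl hf p).totalDegree ≤ p.totalDegree := by
  refine Finset.sup_le fun s hs => ?_
  rw [mem_support_iff, coeff_killCompl] at hs
  have h := le_totalDegree (mem_support_iff.2 hs)
  rwa [Finsupp.sum_mapDomain_index (fun _ => rfl) (fun _ _ _ => rfl)] at h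

/-- The trailing monomial of a sum of compositions with few low-degree inner polynomials has small
support. -/
theorem IsTrailingMonomial.card_support_le {σ ι F : Type*} [Field F] [CharZero F] [Fintype ι]
    {m : MonomialOrder σ} {P : MvPolynomial σ F} {α : σ →₀ ℕ} (h : IsTrailingMonomial m P α)
    {T d : ℕ} (R : Fin T → ι → MvPolynomial σ F) (hR : ∀ i j, (R i j).totalDegree ≤ d + 1)
    (C : Fin T → MvPolynomial ι F) (hP : P = ∑ i, aeval (R i) (C i)) (hT : 0 < T) :
    (α.support.card : ℝ) ≤ 2 * Real.exp 1 ^ 3 * (d + 1) *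
      (Real.log T + Fintype.card ι * Real.log (2 * Fintype.card ι) + 1) := by
  classical
  have hinj : Function.Injective (Subtype.val : {i // i ∈ α.support} → σ) := Subtype.val_injective
  have hα' : (α.comapDomain Subtype.val hinj.injOn : {i // i ∈ α.support} →₀ ℕ).mapDomain
      Subtype.val = α :=
    Finsupp.mapDomain_comapDomain _ hinj _ (by
      rw [Subtype.range_coe_subtype]; exact fun i hi => hi)
  -- Killing the variables outside the support of `α` keeps the coefficients of monomials in the
  -- remaining ones, so `α` stays trailing for the pulled-back order.
  have hP' : killCompl hinj P = ∑ i, aeval (fun j => killCompl hinj (R i j)) (C i) := by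
    rw [hP, map_sum]
    exact Finset.sum_congr rfl fun i _ => by rw [← comp_aeval_apply]
  refine le_of_forall_choose_mul_choose_le hT fun l r => ?_
  have key := choose_mul_choose_le_of_trailing
    ((m.toSyn : (σ →₀ ℕ) →+ m.syn).comp (Finsupp.mapDomain.addMonoidHom Subtype.val))
    (m.toSyn.injective.comp (Finsupp.mapDomain_injective hinj)) _
    (fun i j => (totalDegree_killCompl_le hinj _).trans (hR i j)) C hP'
    (α := α.comapDomain Subtype.val hinj.injOn) (fun i => (Finsupp.mem_support_iff (f := α)).1 i.2)
    (by rw [coeff_killCompl, hα']; exact mem_support_iff.1 h.1)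
    (fun β hβ => by
      rw [coeff_killCompl] at hβ
      show m.toSyn (Finsupp.mapDomain _ _) ≤ m.toSyn (Finsupp.mapDomain _ _)
      rw [hα']
      exact h.2 _ (mem_support_iff.2 hβ)) l r
  rwa [Fintype.card_coe, Nat.add_sub_cancel] at key

theorem lemma5p2 {F : Type*} [Field F] [CharZero F] (N T t d k Δ : ℕ)
    (m : MonomialOrder (Fin N))
    (P : MvPolynomial (Fin N) F) (hP0 : P ≠ 0) (hP : P.IsHomogeneous Δ)
    (C : Fin T → MvPolynomial (Fin t) F)
    (Q : Fin T → Fin t → MvPolynomial (Fin N) F)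
    (hrep : P = ∑ i, aeval (Q i) (C i))
    (hdeg : ∀ i j, (Q i j).totalDegree ≤ d)
    (hrank : ∀ i, algebraicRank (Set.range (Q i)) ≤ (k : ℕ∞)) :
    ∃ α : Fin N →₀ ℕ, IsTrailingMonomial m P α ∧
      (α.support.card : ℝ) ≤
        2 * Real.exp 1 ^ 3 * (d : ℝ) *
          (Real.log ((T : ℝ) * ((Δ : ℝ) + 1)) +
            ((d : ℝ) + 1) * (k : ℝ) * Real.log (2 * ((d : ℝ) + 1) * (k : ℝ)) + 1) := by
  obtain ⟨α, hα⟩ := exists_isTrailingMonomial m hP0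
  refine ⟨α, hα, ?_⟩
  -- For `d = 0` the bound is zero, but `P` is constant and `α = 0`. Otherwise `d` now denotes the
  -- degree bound minus one.
  obtain _ | d := d
  · have hQ : ∀ i j, ∃ c, Q i j = MvPolynomial.C c := fun i j =>
      ⟨_, totalDegree_eq_zero_iff_eq_C.1 (Nat.le_zero.1 (hdeg i j))⟩
    choose c hc using hQ
    have hPc : P.totalDegree = 0 := by
      rw [hrep]
      refine Nat.le_zero.1 (totalDegree_finsetSum_le fun i _ => ?_)
      have : aeval (Q i) (C i) = MvPolynomial.C (aeval (c i) (C i)) := by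
        rw [show Q i = fun j => algebraMap F _ (c i j) from _root_.funext (hc i)]
        exact aeval_algebraMap_apply _ _ _
      rw [this, totalDegree_C]
    have hα0 : α = 0 := by
      have h := le_totalDegree hα.1
      rw [hPc, Nat.le_zero] at h
      exact (Finsupp.degree_eq_zero_iff α).1 h
    simp [hα0]
  · obtain ⟨C', R, hR, hPR⟩ := exists_rep_of_algebraicRank_le hP C Q hrep hdeg hrank
    have hT : 0 < T := by
      rcases Nat.eq_zero_or_pos T with rfl | hT
      · simp [hrep] at hP0
      · exact hT
    have hT' : (0 : ℝ) < T := by exact_mod_cast hT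
    have h := hα.card_support_le R hR C' hPR hT
    -- The graded argument keeps `T` summands, so the factor `Δ + 1` is pure slack.
    have hlog : Real.log T ≤ Real.log ((T : ℝ) * ((Δ : ℝ) + 1)) :=
      Real.log_le_log hT' (le_mul_of_one_le_right hT'.le (by simp))
    rw [Fintype.card_prod, Fintype.card_fin, Fintype.card_fin] at h
    refine h.trans ?_
    push_cast
    rw [show (k : ℝ) * ((d : ℝ) + 1 + 1) = ((d : ℝ) + 1 + 1) * k by ring, ← mul_assoc (2 : ℝ)]
    gcongr
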